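/- All manifolds are smooth, Hausdorff, second countable and without boundary; all tensor fields, vector fields and functions are smooth. An almost contact metric structure on a manifold $M$ consists of a $(1,1)$-tensor field $\phi$, a vector field $\xi$, a $1$-form $\eta$ and a Riemannian metric $g$ with $$\phi^2=-I+\eta\otimes\xi,\qquad \eta(\xi)=1,\qquad g(\phi X,\phi Y)=g(X,Y)-\eta(X)\eta(Y).$$ Put $\Phi(X,Y)=g(X,\phi Y)$. The manifold is almost Kenmotsu if $d\eta=0$ and $d\Phi=2\,\eta\wedge\Phi$. It is Kenmotsu if it is almost Kenmotsu and normal, that is, $[\phi,\phi]+2\,d\eta\otimes\xi=0$, where $$[\phi,\phi](X,Y)=\phi^2[X,Y]+[\phi X,\phi Y]-\phi[\phi X,Y]-\phi[X,\phi Y]$$ and $2\,d\eta(X,Y)=X(\eta(Y))-Y(\eta(X))-\eta([X,Y])$. A vector field $V$ is holomorphically planar conformal (HPCV) if there are functions $a,b$ on $M$ such that $$\nabla_X V=aX+b\,\phi X\qquad\text{for all vector fields }X,$$ where $\nabla$ is the Levi-Civita connection of $g$. **Corollary.** Let $(M,\phi,\xi,\eta,g)$ be a $3$-dimensional almost Kenmotsu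 manifold that admits an HPCV field $V$ with $\phi V=0$ which is non-zero, i.e. vanishes identically on no connected component of $M$ (for connected $M$: $V$ is not identically zero). Then $(M,\phi,\xi,\eta,g)$ is a Kenmotsu manifold. -/

import Mathlib

open Bundle VectorField Set
open scoped Manifold ContDiff Topology

/-! ### The Levi-Civita connection of a smooth Riemannian metric -/

noncomputable section LeviCivita

variable {E : Type*} [NormedAddCommGroup E] [NormedSpace ℝ E]
  {H : Type*} [TopologicalSpace H] {I : ModelWithCorners ℝ E H}
  {M : Type*} [TopologicalSpace M] [ChartedSpace H M] [IsManifold I ∞ M]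
  (g : ContMDiffRiemannianMetric I ∞ E (fun x : M ↦ TangentSpace I x))

/-- The right-hand side of the Koszul formula for `2 g(∇_X Y, Z)`:
`X g(Y,Z) + Y g(X,Z) - Z g(X,Y) + g([X,Y],Z) - g([X,Z],Y) - g([Y,Z],X)`. -/
def koszul (X Y Z : Π x : M, TangentSpace I x) (x : M) : ℝ :=
  mvfderiv I (fun y ↦ g.inner y (Y y) (Z y)) x (X x)
    + mvfderiv I (fun y ↦ g.inner y (X y) (Z y)) x (Y x)
    - mvfderiv I (fun y ↦ g.inner y (X y) (Y y)) x (Z x)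
    + g.inner x (mlieBracket I X Y x) (Z x)
    - g.inner x (mlieBracket I X Z x) (Y x)
    - g.inner x (mlieBracket I Y Z x) (X x)

/-- `g(X, Y)` is differentiable wherever `X` and `Y` are. -/
theorem metric_mdifferentiableAt {x : M} {X Y : Π x : M, TangentSpace I x}
    (hX : MDiffAt (T% X) x) (hY : MDiffAt (T% Y) x) :
    MDiffAt (fun y ↦ g.inner y (X y) (Y y)) x := by
  have hg : MDiffAt (fun b ↦ TotalSpace.mk' (E →L[ℝ] E →L[ℝ] ℝ)
      (E := fun b : M ↦ TangentSpace I b →L[ℝ] TangentSpace I b →L[ℝ] ℝ) b (g.inner b)) x :=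
    (g.contMDiff x).mdifferentiableAt (by simp)
  have : MDifferentiableAt I (I.prod 𝓘(ℝ))
      (fun m ↦ TotalSpace.mk' ℝ (E := Bundle.Trivial M ℝ) m (g.inner m (X m) (Y m))) x := by
    apply MDifferentiableAt.clm_bundle_apply₂ (F₁ := E) (F₂ := E)
    · exact hg
    · exact hX
    · exact hY
  simp only [mdifferentiableAt_totalSpace] at this
  exact this.2

theorem metric_injective (x : M) : Function.Injective (g.inner x) := by
  rw [injective_iff_map_eq_zero]
  intro v hv
  by_contra h
  have := g.pos x v h
  simp [hv] at this

theorem metric_ext {x : M} {v w : TangentSpace I x}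
    (h : ∀ Z : Π x : M, TangentSpace I x, MDiffAt (T% Z) x → g.inner x v (Z x) = g.inner x w (Z x)) :
    v = w := by
  apply metric_injective g x
  ext z
  simpa using h (FiberBundle.extend E z) (FiberBundle.mdifferentiableAt_extend ..)

variable [FiniteDimensional ℝ E]

theorem koszul_tensorial_left {x : M} {Y Z : Π x : M, TangentSpace I x}
    (hY : MDiffAt (T% Y) x) (hZ : MDiffAt (T% Z) x) :
    TensorialAt I E (fun X : Π x : M, TangentSpace I x ↦ koszul g X Y Z x) x where
  smul {f X} hf hX := by
    simp [koszul, mvfderiv_fun_mul hf (metric_mdifferentiableAt g hX hZ),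
      mvfderiv_fun_mul hf (metric_mdifferentiableAt g hX hY), mlieBracket_smul_left hf hX]
    ring
  add hX hX' := by
    simp [koszul,  mvfderiv_fun_add (metric_mdifferentiableAt g hX hZ) (metric_mdifferentiableAt g hX' hZ),
      mvfderiv_fun_add (metric_mdifferentiableAt g hX hY) (metric_mdifferentiableAt g hX' hY), mlieBracket_add_left hX hX']
    ring

theorem koszul_tensorial_right {x : M} {X Y : Π x : M, TangentSpace I x}
    (hX : MDiffAt (T% X) x) (hY : MDiffAt (T% Y) x) :
    TensorialAt I E (fun Z : Π x : M, TangentSpace I x ↦ koszul g X Y Z x) x where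
  smul {f Z} hf hZ := by
    simp [koszul, mvfderiv_fun_mul hf (metric_mdifferentiableAt g hX hZ),
      mvfderiv_fun_mul hf (metric_mdifferentiableAt g hY hZ), mlieBracket_smul_right hf hZ,
      g.symm x (Z x) (X x), g.symm x (Z x) (Y x)]
    ring
  add hZ hZ' := by
    simp [koszul,  mvfderiv_fun_add (metric_mdifferentiableAt g hX hZ) (metric_mdifferentiableAt g hX hZ'),
      mvfderiv_fun_add (metric_mdifferentiableAt g hY hZ) (metric_mdifferentiableAt g hY hZ'), mlieBracket_add_right hZ hZ']
    ring

/-- The isomorphism `v ↦ g(v, ·)` from a tangent space to its dual. -/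
def flat (x : M) : TangentSpace I x ≃ₗ[ℝ] (TangentSpace I x →L[ℝ] ℝ) :=
  haveI : FiniteDimensional ℝ (TangentSpace I x) := inferInstanceAs (FiniteDimensional ℝ E)
  haveI : T2Space (TangentSpace I x) := inferInstanceAs (T2Space E)
  LinearEquiv.ofInjectiveOfFinrankEq (g.inner x).toLinearMap (metric_injective g x) <| by
    rw [← (LinearMap.toContinuousLinearMap (𝕜 := ℝ) (E := TangentSpace I x) (F' := ℝ)).finrank_eq]
    exact Subspace.dual_finrank_eq.symm

theorem flat_symm (x : M) (α : TangentSpace I x →L[ℝ] ℝ) (w : TangentSpace I x) :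
    g.inner x ((flat g x).symm α) w = α w :=
  DFunLike.congr_fun ((flat g x).apply_symm_apply α) w

open Classical in
/-- The operator `Y ↦ (v ↦ ∇_v Y)` determined by the Koszul formula. (Its value at a point where
`Y` is not differentiable is irrelevant; it is set to `0`.) -/
def leviCivitaFun (Y : Π x : M, TangentSpace I x) (x : M) :
    TangentSpace I x →L[ℝ] TangentSpace I x :=
  haveI : FiniteDimensional ℝ (TangentSpace I x) := inferInstanceAs (FiniteDimensional ℝ E)
  haveI : T2Space (TangentSpace I x) := inferInstanceAs (T2Space E)
  if hY : MDiffAt (T% Y) x then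
    LinearMap.toContinuousLinearMap ((flat g x).symm.toLinearMap ∘ₗ ((1 / 2 : ℝ) •
      (TensorialAt.mkHom₂ (fun X Z : Π x : M, TangentSpace I x ↦ koszul g X Y Z x) x
        (fun _ hZ ↦ koszul_tensorial_left g hY hZ)
        (fun _ hX ↦ koszul_tensorial_right g hX hY)).toLinearMap))
  else 0

/-- The Koszul formula. -/
theorem koszul_formula {x : M} {X Y Z : Π x : M, TangentSpace I x}
    (hX : MDiffAt (T% X) x) (hY : MDiffAt (T% Y) x) (hZ : MDiffAt (T% Z) x) :
    2 * g.inner x (leviCivitaFun g Y x (X x)) (Z x) = koszul g X Y Z x := by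
  simp only [leviCivitaFun, dif_pos hY]
  simp [flat_symm]
  exact TensorialAt.mkHom₂_apply (I := I) (F := E) (F' := E) _ _ hX hZ

/-- The Levi-Civita connection of `g`, as a covariant derivative on the tangent bundle. As always for
`CovariantDerivative`, `leviCivita g Y x v` is `∇_v Y` at `x`. That it is torsion-free and
compatible with `g` is `leviCivita_torsion_free` and `leviCivita_metric` below. -/
def leviCivita : CovariantDerivative I E (fun x : M ↦ TangentSpace I x) where
  toFun := leviCivitaFun g
  isCovariantDerivativeOnUniv :=
    { add := by
        intro Y Y' x hY hY' _
        ext v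
        obtain ⟨X, hX, rfl⟩ : ∃ X : Π x : M, TangentSpace I x, MDiffAt (T% X) x ∧ X x = v :=
          ⟨FiberBundle.extend E v, FiberBundle.mdifferentiableAt_extend .., by simp⟩
        apply metric_ext g
        intro Z hZ
        apply mul_left_cancel₀ (two_ne_zero (α := ℝ))
        rw [koszul_formula g hX (mdifferentiableAt_add_section hY hY') hZ]
        simp only [add_apply, map_add, mul_add]
        rw [koszul_formula g hX hY hZ, koszul_formula g hX hY' hZ]
        simp [koszul, mvfderiv_fun_add (metric_mdifferentiableAt g hY hZ) (metric_mdifferentiableAt g hY' hZ),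
          mvfderiv_fun_add (metric_mdifferentiableAt g hX hY) (metric_mdifferentiableAt g hX hY'),
          mlieBracket_add_right hY hY', mlieBracket_add_left hY hY']
        ring
      leibniz := by
        intro Y f x hY hf _
        ext v
        obtain ⟨X, hX, rfl⟩ : ∃ X : Π x : M, TangentSpace I x, MDiffAt (T% X) x ∧ X x = v :=
          ⟨FiberBundle.extend E v, FiberBundle.mdifferentiableAt_extend .., by simp⟩
        apply metric_ext g
        intro Z hZ
        apply mul_left_cancel₀ (two_ne_zero (α := ℝ))
        rw [koszul_formula g hX (hf.smul_section hY) hZ]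
        have key := koszul_formula g hX hY hZ
        simp only [add_apply, map_add, mul_add]
        trans f x * koszul g X Y Z x + 2 * (mvfderiv I f x (X x) * g.inner x (Y x) (Z x))
        · simp [koszul, mvfderiv_fun_mul hf (metric_mdifferentiableAt g hY hZ),
            mvfderiv_fun_mul hf (metric_mdifferentiableAt g hX hY),
            mlieBracket_smul_right hf hY, mlieBracket_smul_left hf hY]
          rw [g.symm x (Y x) (X x)]
          ring
        · rw [← key]
          simp
          ring }

theorem leviCivita_torsion_free {x : M} {X Y : Π x : M, TangentSpace I x}
    (hX : MDiffAt (T% X) x) (hY : MDiffAt (T% Y) x) :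
    leviCivita g Y x (X x) - leviCivita g X x (Y x) = mlieBracket I X Y x := by
  apply metric_ext g
  intro Z hZ
  apply mul_left_cancel₀ (two_ne_zero (α := ℝ))
  have h1 := koszul_formula g hX hY hZ
  have h2 := koszul_formula g hY hX hZ
  rw [map_sub, sub_apply, mul_sub]
  change 2 * g.inner x (leviCivitaFun g Y x (X x)) (Z x) - 2 * g.inner x (leviCivitaFun g X x (Y x)) (Z x) = _
  rw [h1, h2]
  have h3 : (fun y ↦ g.inner y (X y) (Y y)) = fun y ↦ g.inner y (Y y) (X y) :=
    funext fun y ↦ g.symm y _ _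
  simp only [koszul, h3, mlieBracket_swap_apply (V := Y) (W := X)]
  simp
  ring

theorem leviCivita_metric {x : M} {X Y Z : Π x : M, TangentSpace I x}
    (hX : MDiffAt (T% X) x) (hY : MDiffAt (T% Y) x) (hZ : MDiffAt (T% Z) x) :
    mvfderiv I (fun y ↦ g.inner y (Y y) (Z y)) x (X x) =
      g.inner x (leviCivita g Y x (X x)) (Z x) + g.inner x (Y x) (leviCivita g Z x (X x)) := by
  apply mul_left_cancel₀ (two_ne_zero (α := ℝ))
  have h1 := koszul_formula g hX hY hZ
  have h2 := koszul_formula g hX hZ hY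
  rw [mul_add, g.symm x (Y x)]
  change _ = 2 * g.inner x (leviCivitaFun g Y x (X x)) (Z x) + 2 * g.inner x (leviCivitaFun g Z x (X x)) (Y x)
  rw [h1, h2]
  have h3 : (fun y ↦ g.inner y (Y y) (Z y)) = fun y ↦ g.inner y (Z y) (Y y) :=
    funext fun y ↦ g.symm y _ _
  simp only [koszul, h3, mlieBracket_swap_apply (V := Z) (W := Y)]
  simp
  ring
end LeviCivita

/-! ### Almost contact metric structures and almost Kenmotsu manifolds -/

noncomputable section AlmostContact

variable {E : Type*} [NormedAddCommGroup E] [NormedSpace ℝ E]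
  {H : Type*} [TopologicalSpace H] {I : ModelWithCorners ℝ E H}
  {M : Type*} [TopologicalSpace M] [ChartedSpace H M] [IsManifold I ∞ M]

/-- `dα(X, Y) = X(α(Y)) - Y(α(X)) - α([X, Y])`, without a factor `1/2`: in the convention where the
exterior derivative of a `1`-form carries the factor `1/2`, this is `2 dα(X, Y)`. -/
def extDerivOne (α : Π x : M, TangentSpace I x →L[ℝ] ℝ) (X Y : Π x : M, TangentSpace I x)
    (x : M) : ℝ :=
  mvfderiv I (fun y ↦ α y (Y y)) x (X x) - mvfderiv I (fun y ↦ α y (X y)) x (Y x)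
    - α x (mlieBracket I X Y x)

/-- The exterior derivative of a `2`-form:
`dΩ(X, Y, Z) = X(Ω(Y, Z)) + Y(Ω(Z, X)) + Z(Ω(X, Y)) - Ω([X, Y], Z) - Ω([Y, Z], X) - Ω([Z, X], Y)`,
without a factor `1/3`. -/
def extDerivTwo (Ω : Π x : M, TangentSpace I x → TangentSpace I x → ℝ)
    (X Y Z : Π x : M, TangentSpace I x) (x : M) : ℝ :=
  mvfderiv I (fun y ↦ Ω y (Y y) (Z y)) x (X x)
    + mvfderiv I (fun y ↦ Ω y (Z y) (X y)) x (Y x)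
    + mvfderiv I (fun y ↦ Ω y (X y) (Y y)) x (Z x)
    - Ω x (mlieBracket I X Y x) (Z x)
    - Ω x (mlieBracket I Y Z x) (X x)
    - Ω x (mlieBracket I Z X x) (Y x)

/-- The wedge product of a covector and a `2`-form on a tangent space,
`(α ∧ Ω)(u, v, w) = α(u) Ω(v, w) + α(v) Ω(w, u) + α(w) Ω(u, v)`, without a factor `1/3` (as in
`extDerivTwo`, so an equation `dΩ = c α ∧ Ω` has the same meaning in either convention). -/
def wedgeOneTwo {x : M} (α : TangentSpace I x →L[ℝ] ℝ)
    (Ω : TangentSpace I x → TangentSpace I x → ℝ) (u v w : TangentSpace I x) : ℝ :=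
  α u * Ω v w + α v * Ω w u + α w * Ω u v

variable (I M) in
/-- A smooth almost contact metric structure `(φ, ξ, η, g)` on `M`. -/
structure AlmostContactMetricStructure where
  /-- The `(1,1)`-tensor field. -/
  φ : Π x : M, TangentSpace I x →L[ℝ] TangentSpace I x
  /-- The characteristic vector field. -/
  ξ : Π x : M, TangentSpace I x
  /-- The `1`-form. -/
  η : Π x : M, TangentSpace I x →L[ℝ] ℝ
  /-- The Riemannian metric. -/
  g : ContMDiffRiemannianMetric I ∞ E (fun x : M ↦ TangentSpace I x)
  contMDiff_φ : ContMDiff I (I.prod 𝓘(ℝ, E →L[ℝ] E)) ∞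
    (fun x ↦ TotalSpace.mk' (E →L[ℝ] E)
      (E := fun x : M ↦ TangentSpace I x →L[ℝ] TangentSpace I x) x (φ x))
  contMDiff_ξ : ContMDiff I I.tangent ∞ (fun x ↦ (⟨x, ξ x⟩ : TangentBundle I M))
  contMDiff_η : ContMDiff I (I.prod 𝓘(ℝ, E →L[ℝ] ℝ)) ∞
    (fun x ↦ TotalSpace.mk' (E →L[ℝ] ℝ)
      (E := fun x : M ↦ TangentSpace I x →L[ℝ] ℝ) x (η x))
  φ_φ : ∀ (x : M) (v : TangentSpace I x), φ x (φ x v) = -v + η x v • ξ x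
  η_ξ : ∀ x : M, η x (ξ x) = 1
  metric_φ_φ : ∀ (x : M) (v w : TangentSpace I x),
    g.inner x (φ x v) (φ x w) = g.inner x v w - η x v * η x w

namespace AlmostContactMetricStructure

variable (S : AlmostContactMetricStructure I M)

/-- The fundamental `2`-form `Φ(v, w) = g(v, φ w)`. -/
def fundamentalForm (x : M) (v w : TangentSpace I x) : ℝ := S.g.inner x v (S.φ x w)

/-- `dη = 0` and `dΦ = 2 η ∧ Φ`. Both sides are tensorial, so at each point `x` the identities are
stated for all vector fields that are differentiable at `x`. -/
structure IsAlmostKenmotsu : Prop where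
  closed : ∀ (x : M) (X Y : Π x : M, TangentSpace I x),
    MDiffAt (T% X) x → MDiffAt (T% Y) x → extDerivOne S.η X Y x = 0
  extDeriv_fundamentalForm : ∀ (x : M) (X Y Z : Π x : M, TangentSpace I x),
    MDiffAt (T% X) x → MDiffAt (T% Y) x → MDiffAt (T% Z) x →
      extDerivTwo S.fundamentalForm X Y Z x =
        2 * wedgeOneTwo (S.η x) (S.fundamentalForm x) (X x) (Y x) (Z x)

/-- The Nijenhuis tensor `[φ, φ](X, Y) = φ²[X, Y] + [φX, φY] - φ[φX, Y] - φ[X, φY]`. -/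
def nijenhuis (X Y : Π x : M, TangentSpace I x) (x : M) : TangentSpace I x :=
  S.φ x (S.φ x (mlieBracket I X Y x))
    + mlieBracket I (fun y ↦ S.φ y (X y)) (fun y ↦ S.φ y (Y y)) x
    - S.φ x (mlieBracket I (fun y ↦ S.φ y (X y)) Y x)
    - S.φ x (mlieBracket I X (fun y ↦ S.φ y (Y y)) x)

/-- Normality: the tensor `N = [φ, φ] + 2 dη ⊗ ξ` vanishes. Here `dη` is taken with the factor `1/2`,
so that `2 dη` is `extDerivOne S.η`. -/
def IsNormal : Prop :=
  ∀ (x : M) (X Y : Π x : M, TangentSpace I x), MDiffAt (T% X) x → MDiffAt (T% Y) x →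
    S.nijenhuis X Y x + extDerivOne S.η X Y x • S.ξ x = 0

/-- A Kenmotsu manifold is a normal almost Kenmotsu manifold. -/
def IsKenmotsu : Prop := S.IsAlmostKenmotsu ∧ S.IsNormal

/-- A smooth vector field `V` is holomorphically planar conformal if `∇_X V = a X + b φX` for all
`X`, for some smooth functions `a`, `b`; here `∇` is the Levi-Civita connection of `g`. -/
def IsHPCV [FiniteDimensional ℝ E] (V : Π x : M, TangentSpace I x) : Prop :=
  ContMDiff I I.tangent ∞ (fun x ↦ (⟨x, V x⟩ : TangentBundle I M)) ∧
    ∃ a b : M → ℝ, ContMDiff I 𝓘(ℝ) ∞ a ∧ ContMDiff I 𝓘(ℝ) ∞ b ∧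
      ∀ (x : M) (v : TangentSpace I x), leviCivita S.g V x v = a x • v + b x • S.φ x v

end AlmostContactMetricStructure

end AlmostContact

/-! Since `φ V = 0`, `φ² = -1 + η ⊗ ξ` gives `V = f ξ` with `f = η(V)`, and the HPCV equation reads
`f ∇_X ξ + (X f) ξ = a X + b φX`. As `ξ` has unit length, its `η`-component is `df = a η`. On `ker
η` the symmetry of `∇ξ`, equivalent to `dη = 0`, forces `b = 0`, while `dΦ = 2 η ∧ Φ` fixes the
trace of `∇ξ` as `2` and forces `a = f` (`trace_leviCivita_ξ`). Hence `df = f η` and `f ∇ξ = f (1 -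
η ⊗ ξ)` (`of_isHPCV`). The equation `df = f η` makes the zero set of `f` open and closed
(`isClopen_zeros_of_mvfderiv_eq_mul`), so `f` has no zeros and `∇ξ = 1 - η ⊗ ξ` everywhere. In
dimension three `∇φ` is determined by `∇ξ` (`covDerivφ_eq`), and substitution into the Nijenhuis
tensor gives `0` (`nijenhuis_eq_zero`). -/

noncomputable section

namespace AlmostContactMetricStructure

variable {E : Type*} [NormedAddCommGroup E] [NormedSpace ℝ E]
  {H : Type*} [TopologicalSpace H] {I : ModelWithCorners ℝ E H}
  {M : Type*} [TopologicalSpace M] [ChartedSpace H M] [IsManifold I ∞ M]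
  (S : AlmostContactMetricStructure I M)

/-! ### Pointwise algebra of an almost contact metric structure -/

/-- Evaluating `φ³ ξ` in two ways shows `φ ξ = c ξ`; then `0 = φ² ξ = c² ξ`. -/
theorem φ_ξ (x : M) : S.φ x (S.ξ x) = 0 := by
  have h1 : S.φ x (S.φ x (S.ξ x)) = 0 := by simp [S.φ_φ, S.η_ξ]
  have h2 := S.φ_φ x (S.φ x (S.ξ x))
  rw [h1, map_zero] at h2
  have h3 : S.φ x (S.ξ x) = S.η x (S.φ x (S.ξ x)) • S.ξ x := by
    rw [eq_comm, neg_add_eq_zero] at h2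
    exact h2
  set c := S.η x (S.φ x (S.ξ x))
  have h4 : c * c = 0 := by
    have h5 := congrArg (S.η x) h1
    rw [h3, map_smul, h3, smul_smul, map_smul, S.η_ξ, map_zero] at h5
    simpa using h5
  rw [h3, mul_self_eq_zero.mp h4, zero_smul]

/-- Compare `φ² (φ v)` with `φ (φ² v)`; they differ by `η(φ v) ξ`. -/
theorem η_φ (x : M) (v : TangentSpace I x) : S.η x (S.φ x v) = 0 := by
  have h1 := S.φ_φ x (S.φ x v)
  have h2 := congrArg (S.φ x) (S.φ_φ x v)
  rw [map_add, map_neg, map_smul, S.φ_ξ, smul_zero, add_zero] at h2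
  have h3 := congrArg (S.η x) (h2.symm.trans h1)
  simpa [S.η_ξ] using h3

theorem inner_ξ_right (x : M) (v : TangentSpace I x) : S.g.inner x v (S.ξ x) = S.η x v := by
  have h := S.metric_φ_φ x v (S.ξ x)
  rw [S.φ_ξ, map_zero, S.η_ξ] at h
  linarith

theorem inner_ξ_left (x : M) (v : TangentSpace I x) : S.g.inner x (S.ξ x) v = S.η x v := by
  rw [S.g.symm, S.inner_ξ_right]

theorem inner_φ_left (x : M) (v w : TangentSpace I x) :
    S.g.inner x (S.φ x v) w = -S.g.inner x v (S.φ x w) := by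
  have h := S.metric_φ_φ x v (S.φ x w)
  simp only [S.φ_φ, map_add, map_neg, map_smul, S.inner_ξ_right, S.η_φ, smul_eq_mul] at h
  linarith

theorem inner_φ_self (x : M) (v : TangentSpace I x) : S.g.inner x v (S.φ x v) = 0 := by
  have h := S.inner_φ_left x v v
  rw [S.g.symm] at h
  linarith

/-! ### Regularity of the structure tensors -/

theorem mdifferentiableAt_ξ (x : M) : MDiffAt (T% S.ξ) x :=
  (S.contMDiff_ξ x).mdifferentiableAt (by simp)

theorem mdifferentiableAt_φ {x : M} {Y : Π x : M, TangentSpace I x} (hY : MDiffAt (T% Y) x) :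
    MDiffAt (T% (fun y ↦ S.φ y (Y y))) x :=
  MDifferentiableAt.clm_bundle_apply (F₁ := E) (F₂ := E)
    ((S.contMDiff_φ x).mdifferentiableAt (by simp)) hY

theorem contMDiff_η_apply {V : Π x : M, TangentSpace I x}
    (hV : ContMDiff I I.tangent ∞ (fun x ↦ (⟨x, V x⟩ : TangentBundle I M))) :
    ContMDiff I 𝓘(ℝ) ∞ (fun x ↦ S.η x (V x)) := by
  intro x
  have h : ContMDiffAt I (I.prod 𝓘(ℝ)) ∞
      (fun m ↦ TotalSpace.mk' ℝ (E := Bundle.Trivial M ℝ) m (S.η m (V m))) x :=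
    ContMDiffAt.clm_bundle_apply (F₁ := E) (F₂ := ℝ) (S.contMDiff_η x) (hV x)
  simp only [contMDiffAt_totalSpace] at h
  exact h.2

theorem mdifferentiableAt_η {x : M} {Y : Π x : M, TangentSpace I x} (hY : MDiffAt (T% Y) x) :
    MDiffAt (fun y ↦ S.η y (Y y)) x := by
  simpa only [S.inner_ξ_left] using metric_mdifferentiableAt S.g (S.mdifferentiableAt_ξ x) hY

variable [FiniteDimensional ℝ E]


/-! ### The covariant derivatives of the structure tensors -/

theorem leviCivita_metric_apply {x : M} {Y Z : Π x : M, TangentSpace I x}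
    (v : TangentSpace I x) (hY : MDiffAt (T% Y) x) (hZ : MDiffAt (T% Z) x) :
    mvfderiv I (fun y ↦ S.g.inner y (Y y) (Z y)) x v =
      S.g.inner x (leviCivita S.g Y x v) (Z x) + S.g.inner x (Y x) (leviCivita S.g Z x v) := by
  obtain ⟨X, hX, rfl⟩ : ∃ X : Π x : M, TangentSpace I x, MDiffAt (T% X) x ∧ X x = v :=
    ⟨FiberBundle.extend E v, FiberBundle.mdifferentiableAt_extend .., by simp⟩
  exact leviCivita_metric S.g hX hY hZ

theorem η_leviCivita_ξ (x : M) (v : TangentSpace I x) :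
    S.η x (leviCivita S.g S.ξ x v) = 0 := by
  have h := S.leviCivita_metric_apply v (S.mdifferentiableAt_ξ x) (S.mdifferentiableAt_ξ x)
  simp only [S.inner_ξ_left, S.inner_ξ_right, S.η_ξ, mvfderiv_const, zero_apply] at h
  linarith

theorem mvfderiv_η {x : M} {Y : Π x : M, TangentSpace I x}
    (v : TangentSpace I x) (hY : MDiffAt (T% Y) x) :
    mvfderiv I (fun y ↦ S.η y (Y y)) x v =
      S.g.inner x (leviCivita S.g S.ξ x v) (Y x) + S.η x (leviCivita S.g Y x v) := by
  simpa only [S.inner_ξ_left] using S.leviCivita_metric_apply v (S.mdifferentiableAt_ξ x) hY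

/-- `extDerivOne S.η` in terms of `∇ξ`. -/
theorem extDerivOne_η {x : M} {X Y : Π x : M, TangentSpace I x}
    (hX : MDiffAt (T% X) x) (hY : MDiffAt (T% Y) x) :
    extDerivOne S.η X Y x = S.g.inner x (leviCivita S.g S.ξ x (X x)) (Y x)
      - S.g.inner x (leviCivita S.g S.ξ x (Y x)) (X x) := by
  rw [extDerivOne, S.mvfderiv_η _ hX, S.mvfderiv_η _ hY, ← leviCivita_torsion_free S.g hX hY,
    map_sub]
  ring

/-- The covariant derivative `(∇_v φ) Y` at `x`, for a vector field `Y`. -/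
def covDerivφ (Y : Π x : M, TangentSpace I x) (x : M) (v : TangentSpace I x) :
    TangentSpace I x :=
  leviCivita S.g (fun y ↦ S.φ y (Y y)) x v - S.φ x (leviCivita S.g Y x v)

theorem leviCivita_φ (Y : Π x : M, TangentSpace I x) (x : M) (v : TangentSpace I x) :
    leviCivita S.g (fun y ↦ S.φ y (Y y)) x v =
      S.covDerivφ Y x v + S.φ x (leviCivita S.g Y x v) := by
  simp [covDerivφ]

/-- The derivative of the skew-symmetry `g(φY, Z) = -g(Y, φZ)`. -/
theorem inner_covDerivφ {x : M} {Y Z : Π x : M, TangentSpace I x}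
    (v : TangentSpace I x) (hY : MDiffAt (T% Y) x) (hZ : MDiffAt (T% Z) x) :
    S.g.inner x (S.covDerivφ Y x v) (Z x) = -S.g.inner x (Y x) (S.covDerivφ Z x v) := by
  have h1 := S.leviCivita_metric_apply v (S.mdifferentiableAt_φ hY) hZ
  have h2 := S.leviCivita_metric_apply v hY (S.mdifferentiableAt_φ hZ)
  simp only [S.inner_φ_left] at h1
  rw [show (fun y ↦ -S.g.inner y (Y y) (S.φ y (Z y))) = -(fun y ↦ S.g.inner y (Y y) (S.φ y (Z y)))
    from rfl, mvfderiv_neg, neg_apply, h2] at h1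
  simp only [leviCivita_φ, map_add, add_apply, S.inner_φ_left] at h1
  linarith

theorem covDerivφ_ξ (x : M) (v : TangentSpace I x) :
    S.covDerivφ S.ξ x v = -S.φ x (leviCivita S.g S.ξ x v) := by
  have h : (fun y ↦ S.φ y (S.ξ y)) = 0 := funext fun y ↦ S.φ_ξ y
  rw [covDerivφ, h, CovariantDerivative.zero]
  simp

theorem leviCivita_smul {x : M} {f : M → ℝ} {Y : Π x : M, TangentSpace I x}
    (hf : MDiffAt f x) (hY : MDiffAt (T% Y) x) (v : TangentSpace I x) :
    leviCivita S.g (fun y ↦ f y • Y y) x v =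
      f x • leviCivita S.g Y x v + mvfderiv I f x v • Y x := by
  have h := (leviCivita S.g).isCovariantDerivativeOnUniv.leibniz hY hf (mem_univ x)
  have h' := congrArg (fun L ↦ L v) h
  change leviCivita S.g (f • Y) x v = _
  simpa using h'

/-- The covariant derivative of the identity `φ² = -1 + η ⊗ ξ`. -/
theorem covDerivφ_φ {x : M} {Y : Π x : M, TangentSpace I x}
    (v : TangentSpace I x) (hY : MDiffAt (T% Y) x) :
    S.covDerivφ (fun y ↦ S.φ y (Y y)) x v + S.φ x (S.covDerivφ Y x v) =
      S.g.inner x (leviCivita S.g S.ξ x v) (Y x) • S.ξ x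
        + S.η x (Y x) • leviCivita S.g S.ξ x v := by
  have hη := S.mdifferentiableAt_η hY
  have hξ := S.mdifferentiableAt_ξ x
  -- Writing `-Y` as a constant function times `Y` lets one Leibniz rule treat both summands.
  have h1 : (fun y ↦ S.φ y (S.φ y (Y y))) =
      (fun y ↦ (-1 : ℝ) • Y y) + fun y ↦ S.η y (Y y) • S.ξ y := by
    funext y
    simp [S.φ_φ]
  have h2 : leviCivita S.g (fun y ↦ S.φ y (S.φ y (Y y))) x v =
      leviCivita S.g (fun y ↦ (-1 : ℝ) • Y y) x v
        + leviCivita S.g (fun y ↦ S.η y (Y y) • S.ξ y) x v := by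
    rw [h1]
    exact congrArg (fun L ↦ L v) ((leviCivita S.g).isCovariantDerivativeOnUniv.add
      (mdifferentiableAt_const.smul_section hY) (hη.smul_section hξ) (mem_univ x))
  rw [S.leviCivita_smul mdifferentiableAt_const hY, S.leviCivita_smul hη hξ, mvfderiv_const,
    S.mvfderiv_η v hY, S.leviCivita_φ, S.leviCivita_φ, map_add, S.φ_φ, zero_apply] at h2
  rw [← sub_eq_zero] at h2 ⊢
  rw [← h2]
  module

/-- `dΦ` in terms of `∇φ`. -/
theorem extDerivTwo_fundamentalForm {x : M} {X Y Z : Π x : M, TangentSpace I x}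
    (hX : MDiffAt (T% X) x) (hY : MDiffAt (T% Y) x) (hZ : MDiffAt (T% Z) x) :
    extDerivTwo S.fundamentalForm X Y Z x =
      S.g.inner x (Y x) (S.covDerivφ Z x (X x)) + S.g.inner x (Z x) (S.covDerivφ X x (Y x))
        + S.g.inner x (X x) (S.covDerivφ Y x (Z x)) := by
  simp only [extDerivTwo, fundamentalForm]
  rw [S.leviCivita_metric_apply _ hY (S.mdifferentiableAt_φ hZ),
    S.leviCivita_metric_apply _ hZ (S.mdifferentiableAt_φ hX),
    S.leviCivita_metric_apply _ hX (S.mdifferentiableAt_φ hY),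
    ← leviCivita_torsion_free S.g hX hY, ← leviCivita_torsion_free S.g hY hZ,
    ← leviCivita_torsion_free S.g hZ hX]
  have k : ∀ u v : TangentSpace I x, S.g.inner x u (S.φ x v) = -S.g.inner x v (S.φ x u) := by
    intro u v
    rw [← S.inner_φ_left, S.g.symm]
  simp only [leviCivita_φ, map_add, map_sub, sub_apply]
  -- Skewness of `φ` brings these three terms into the form in which they cancel against the bracket
  -- terms.
  rw [k (X x) (leviCivita S.g Y x (Z x)), k (Y x) (leviCivita S.g Z x (X x)),
    k (Z x) (leviCivita S.g X x (Y x))]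
  ring

/-- The Nijenhuis tensor of `φ` in terms of `∇φ`. -/
theorem nijenhuis_eq {x : M} {X Y : Π x : M, TangentSpace I x}
    (hX : MDiffAt (T% X) x) (hY : MDiffAt (T% Y) x) :
    S.nijenhuis X Y x = S.covDerivφ Y x (S.φ x (X x)) - S.covDerivφ X x (S.φ x (Y x))
      + S.φ x (S.covDerivφ X x (Y x)) - S.φ x (S.covDerivφ Y x (X x)) := by
  have hX' := S.mdifferentiableAt_φ hX
  have hY' := S.mdifferentiableAt_φ hY
  rw [nijenhuis, ← leviCivita_torsion_free S.g hX hY, ← leviCivita_torsion_free S.g hX' hY,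
    ← leviCivita_torsion_free S.g hX hY', ← leviCivita_torsion_free S.g hX' hY']
  simp only [leviCivita_φ, map_add, map_sub]
  abel

end AlmostContactMetricStructure

end

noncomputable section

namespace AlmostContactMetricStructure

variable {E : Type*} [NormedAddCommGroup E] [NormedSpace ℝ E]
  {H : Type*} [TopologicalSpace H] {I : ModelWithCorners ℝ E H}
  {M : Type*} [TopologicalSpace M] [ChartedSpace H M] [IsManifold I ∞ M]
  (S : AlmostContactMetricStructure I M)

/-! ### Adapted frames in dimension three -/

/-- A unit vector `e` orthogonal to `ξ`; in dimension three it completes to the frame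
`ξ, e, φ e`. -/
structure IsAdapted (x : M) (e : TangentSpace I x) : Prop where
  norm : S.g.inner x e e = 1
  η_eq_zero : S.η x e = 0

theorem exists_isAdapted (hE : Module.finrank ℝ E = 3) (x : M) : ∃ e, S.IsAdapted x e := by
  have hT : Module.finrank ℝ (TangentSpace I x) = 3 := hE
  have : FiniteDimensional ℝ (TangentSpace I x) := Module.finite_of_finrank_pos (by omega)
  obtain ⟨v, hv, hv0⟩ : ∃ v : TangentSpace I x, S.η x v = 0 ∧ v ≠ 0 := by
    by_contra! h
    have hinj : Function.Injective (S.η x).toLinearMap :=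
      (injective_iff_map_eq_zero (S.η x).toLinearMap).mpr h
    have := LinearMap.finrank_le_finrank_of_injective hinj
    simp [hT] at this
  have hpos := S.g.pos x v hv0
  refine ⟨(√(S.g.inner x v v))⁻¹ • v, ?_, by simp [hv]⟩
  have hs := Real.mul_self_sqrt hpos.le
  have hs0 := (Real.sqrt_pos.mpr hpos).ne'
  simp only [map_smul, smul_apply, smul_eq_mul]
  field_simp
  linarith

namespace IsAdapted

variable {S} {x : M} {e : TangentSpace I x}

theorem norm_φ (he : S.IsAdapted x e) : S.g.inner x (S.φ x e) (S.φ x e) = 1 := by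
  simp [S.metric_φ_φ, he.norm, he.η_eq_zero]

theorem inner_φ_left (_he : S.IsAdapted x e) : S.g.inner x (S.φ x e) e = 0 := by
  rw [S.g.symm, S.inner_φ_self]

theorem φ_φ (he : S.IsAdapted x e) : S.φ x (S.φ x e) = -e := by
  simp [S.φ_φ, he.η_eq_zero]

theorem expansion (he : S.IsAdapted x e) (hE : Module.finrank ℝ E = 3) (v : TangentSpace I x) :
    v = S.η x v • S.ξ x + S.g.inner x v e • e + S.g.inner x v (S.φ x e) • S.φ x e := by
  have hT : Module.finrank ℝ (TangentSpace I x) = 3 := hE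
  have : FiniteDimensional ℝ (TangentSpace I x) := Module.finite_of_finrank_pos (by omega)
  -- Orthonormality reads off the coefficients: used with `w = 0` for independence, then with `w =
  -- v`.
  have key : ∀ a b c : ℝ, ∀ w : TangentSpace I x, a • S.ξ x + b • e + c • S.φ x e = w →
      a = S.η x w ∧ b = S.g.inner x w e ∧ c = S.g.inner x w (S.φ x e) := by
    rintro a b c w rfl
    simp [S.η_ξ, S.η_φ, he.η_eq_zero, S.inner_ξ_left, he.norm, he.norm_φ, he.inner_φ_left,
      S.inner_φ_self]
  have hli : LinearIndependent ℝ ![S.ξ x, e, S.φ x e] := by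
    rw [Fintype.linearIndependent_iff]
    intro c hc
    simp only [Fin.sum_univ_three, Matrix.cons_val] at hc
    obtain ⟨h0, h1, h2⟩ := key _ _ _ _ hc
    simp only [map_zero, zero_apply] at h0 h1 h2
    intro i
    fin_cases i
    exacts [h0, h1, h2]
  have hspan := hli.span_eq_top_of_card_eq_finrank (by simp [hT])
  have hv : v ∈ Submodule.span ℝ (range ![S.ξ x, e, S.φ x e]) := by rw [hspan]; trivial
  rw [Submodule.mem_span_range_iff_exists_fun] at hv
  obtain ⟨c, hc⟩ := hv
  simp only [Fin.sum_univ_three, Matrix.cons_val] at hc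
  obtain ⟨h0, h1, h2⟩ := key _ _ _ _ hc
  rw [← h0, ← h1, ← h2, hc]

theorem ext (he : S.IsAdapted x e) (hE : Module.finrank ℝ E = 3) {v w : TangentSpace I x}
    (h0 : S.η x v = S.η x w) (h1 : S.g.inner x v e = S.g.inner x w e)
    (h2 : S.g.inner x v (S.φ x e) = S.g.inner x w (S.φ x e)) : v = w := by
  rw [he.expansion hE v, he.expansion hE w, h0, h1, h2]

variable [FiniteDimensional ℝ E]

/-- Put `A = ∇_v φ`. Skewness kills `g(Ae, e)` and `g(Aφe, φe)` and gives `g(Ae, φe) = -g(Aφe, e)`;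
the derivative of `φ² = -1 + η ⊗ ξ` makes these two equal, so both vanish. Only `ξ`-components
remain, and skewness reduces them to `Aξ = -φ ∇_v ξ`. -/
theorem covDerivφ_eq (he : S.IsAdapted x e) (hE : Module.finrank ℝ E = 3)
    {Y : Π x : M, TangentSpace I x} (hY : MDiffAt (T% Y) x) (hYe : Y x = e)
    (v : TangentSpace I x) :
    S.covDerivφ Y x v = S.g.inner x (S.φ x (leviCivita S.g S.ξ x v)) e • S.ξ x ∧
    S.covDerivφ (fun y ↦ S.φ y (Y y)) x v =
      S.g.inner x (S.φ x (leviCivita S.g S.ξ x v)) (S.φ x e) • S.ξ x := by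
  have hY' := S.mdifferentiableAt_φ hY
  have hξ := S.mdifferentiableAt_ξ x
  have h1 := S.inner_covDerivφ v hY hY
  have h2 := S.inner_covDerivφ v hY' hY'
  have h3 := S.inner_covDerivφ v hY hY'
  have h4 := congrArg (fun w ↦ S.g.inner x w e) (S.covDerivφ_φ v hY)
  have h5 := S.inner_covDerivφ v hY hξ
  have h6 := S.inner_covDerivφ v hY' hξ
  have h7 := S.g.symm x e (S.covDerivφ (fun y ↦ S.φ y (Y y)) x v)
  simp only [S.inner_ξ_right, S.covDerivφ_ξ, hYe, map_neg, neg_neg, map_add, add_apply, map_smul,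
    smul_apply, smul_eq_mul, S.inner_ξ_left, he.η_eq_zero, zero_mul, mul_zero,
    add_zero] at h1 h2 h3 h4 h5 h6
  rw [S.g.symm x e] at h1
  rw [S.g.symm x (S.φ x e)] at h2
  rw [S.inner_φ_left] at h4
  constructor
  · apply he.ext hE
    · simp [S.η_ξ, h5, S.g.symm x _ e]
    · simp [S.inner_ξ_left, he.η_eq_zero]; linarith
    · simp [S.inner_ξ_left, S.η_φ]; linarith
  · apply he.ext hE
    · simp [S.η_ξ, h6, S.g.symm x _ (S.φ x e)]
    · simp [S.inner_ξ_left, he.η_eq_zero]; linarith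
    · simp [S.inner_ξ_left, S.η_φ]; linarith

end IsAdapted

variable [FiniteDimensional ℝ E]

/-- In dimension three, `(∇_v φ) Y = g(φ ∇_v ξ, Y) ξ - η(Y) φ ∇_v ξ`. -/
theorem covDerivφ_eq (hE : Module.finrank ℝ E = 3) {x : M} {Y : Π x : M, TangentSpace I x}
    (hY : MDiffAt (T% Y) x) (v : TangentSpace I x) :
    S.covDerivφ Y x v = S.g.inner x (S.φ x (leviCivita S.g S.ξ x v)) (Y x) • S.ξ x
      - S.η x (Y x) • S.φ x (leviCivita S.g S.ξ x v) := by
  obtain ⟨e, he⟩ := S.exists_isAdapted hE x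
  obtain ⟨Z, hZ, rfl⟩ : ∃ Z : Π x : M, TangentSpace I x, MDiffAt (T% Z) x ∧ Z x = e :=
    ⟨FiberBundle.extend E e, FiberBundle.mdifferentiableAt_extend .., by simp⟩
  obtain ⟨h1, h2⟩ := he.covDerivφ_eq hE hZ rfl v
  -- Skewness moves `∇_v φ` from `Y` to the frame `ξ, e, φe`, where it is known.
  have h3 := S.inner_covDerivφ v hY hZ
  have h4 := S.inner_covDerivφ v hY (S.mdifferentiableAt_φ hZ)
  have h5 := S.inner_covDerivφ v hY (S.mdifferentiableAt_ξ x)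
  rw [h1] at h3
  rw [h2] at h4
  rw [S.covDerivφ_ξ, S.inner_ξ_right] at h5
  apply he.ext hE
  · simp [S.η_ξ, S.η_φ, h5, S.g.symm x (Y x)]
  · simp [h3, S.inner_ξ_left, S.inner_ξ_right, he.η_eq_zero]; ring
  · simp [h4, S.inner_ξ_left, S.inner_ξ_right, S.η_φ]; ring

/-- In dimension three, `∇ξ = 1 - η ⊗ ξ` and `dη = 0` imply normality. -/
theorem nijenhuis_eq_zero (hE : Module.finrank ℝ E = 3) {x : M} {X Y : Π x : M, TangentSpace I x}
    (hX : MDiffAt (T% X) x) (hY : MDiffAt (T% Y) x)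
    (hξ : ∀ v, leviCivita S.g S.ξ x v = v - S.η x v • S.ξ x) : S.nijenhuis X Y x = 0 := by
  rw [S.nijenhuis_eq hX hY]
  simp only [S.covDerivφ_eq hE hX, S.covDerivφ_eq hE hY, hξ, map_sub, map_smul, S.φ_ξ, S.φ_φ,
    S.η_φ, S.inner_φ_left, map_add, map_neg, smul_apply,
    smul_zero, sub_zero, zero_smul, smul_eq_mul, neg_apply, add_apply, S.inner_ξ_left]
  -- Here `(∇_v φ) Y = g(φv, Y) ξ - η(Y) φv`; the remaining `ξ`-terms cancel because `φ²` is
  -- symmetric.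
  rw [S.g.symm x (Y x) (X x)]
  module

/-! ### Almost Kenmotsu structures in dimension three -/

variable {S}

theorem IsAlmostKenmotsu.inner_leviCivita_ξ_comm (hS : S.IsAlmostKenmotsu) (x : M)
    (v w : TangentSpace I x) :
    S.g.inner x (leviCivita S.g S.ξ x v) w = S.g.inner x (leviCivita S.g S.ξ x w) v := by
  obtain ⟨X, hX, rfl⟩ : ∃ X : Π x : M, TangentSpace I x, MDiffAt (T% X) x ∧ X x = v :=
    ⟨FiberBundle.extend E v, FiberBundle.mdifferentiableAt_extend .., by simp⟩
  obtain ⟨Y, hY, rfl⟩ : ∃ Y : Π x : M, TangentSpace I x, MDiffAt (T% Y) x ∧ Y x = w :=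
    ⟨FiberBundle.extend E w, FiberBundle.mdifferentiableAt_extend .., by simp⟩
  have h := hS.closed x X Y hX hY
  rw [S.extDerivOne_η hX hY] at h
  linarith

/-- The divergence of `ξ` on a three-dimensional almost Kenmotsu manifold is `2`. -/
theorem IsAlmostKenmotsu.trace_leviCivita_ξ (hS : S.IsAlmostKenmotsu)
    (hE : Module.finrank ℝ E = 3) {x : M} {e : TangentSpace I x} (he : S.IsAdapted x e) :
    S.g.inner x (leviCivita S.g S.ξ x e) e
      + S.g.inner x (leviCivita S.g S.ξ x (S.φ x e)) (S.φ x e) = 2 := by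
  obtain ⟨Z, hZ, rfl⟩ : ∃ Z : Π x : M, TangentSpace I x, MDiffAt (T% Z) x ∧ Z x = e :=
    ⟨FiberBundle.extend E e, FiberBundle.mdifferentiableAt_extend .., by simp⟩
  have hξ := S.mdifferentiableAt_ξ x
  have hZ' := S.mdifferentiableAt_φ hZ
  -- On `(ξ, e, φe)` the left side is minus the trace of `∇ξ` on `ker η`, and the right side is `2
  -- Φ(e, φe) = -2`.
  have h := hS.extDeriv_fundamentalForm x _ _ _ hξ hZ hZ'
  rw [S.extDerivTwo_fundamentalForm hξ hZ hZ', S.covDerivφ_ξ, (he.covDerivφ_eq hE hZ rfl _).1,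
    (he.covDerivφ_eq hE hZ rfl _).2] at h
  simp only [wedgeOneTwo, fundamentalForm, map_smul, map_neg, S.inner_ξ_right, S.inner_ξ_left,
    he.η_eq_zero, S.η_ξ, S.η_φ, he.φ_φ, he.norm, S.metric_φ_φ, smul_eq_mul] at h
  rw [S.inner_φ_left, S.g.symm x (Z x)] at h
  linarith

/-- On a three-dimensional almost Kenmotsu manifold, an HPCV field `V` in the kernel of `φ` has
`d(η(V)) = η(V) η` and `∇ξ = 1 - η ⊗ ξ` where it does not vanish. -/
theorem IsAlmostKenmotsu.of_isHPCV (hS : S.IsAlmostKenmotsu)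
    (hE : Module.finrank ℝ E = 3) {V : Π x : M, TangentSpace I x} (hV : S.IsHPCV V)
    (hφV : ∀ x : M, S.φ x (V x) = 0) (x : M) (v : TangentSpace I x) :
    mvfderiv I (fun y ↦ S.η y (V y)) x v = S.η x (V x) * S.η x v ∧
    S.η x (V x) • leviCivita S.g S.ξ x v = S.η x (V x) • (v - S.η x v • S.ξ x) := by
  obtain ⟨hVs, a, b, -, -, hab⟩ := hV
  have hVξ : V = fun y ↦ S.η y (V y) • S.ξ y := by
    funext y
    have h := S.φ_φ y (V y)
    rw [hφV, map_zero, eq_comm, neg_add_eq_zero] at h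
    exact h
  have hVd : MDiffAt (T% V) x := (hVs x).mdifferentiableAt (by simp)
  have key : ∀ w, S.η x (V x) • leviCivita S.g S.ξ x w
      + mvfderiv I (fun y ↦ S.η y (V y)) x w • S.ξ x = a x • w + b x • S.φ x w := by
    intro w
    rw [← S.leviCivita_smul (S.mdifferentiableAt_η hVd) (S.mdifferentiableAt_ξ x), ← hVξ, hab]
  have hη : ∀ w, mvfderiv I (fun y ↦ S.η y (V y)) x w = a x * S.η x w := by
    intro w
    have h := congrArg (S.η x) (key w)
    simpa [S.η_ξ, S.η_φ, S.η_leviCivita_ξ] using h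
  obtain ⟨e, he⟩ := S.exists_isAdapted hE x
  have h1 := congrArg (fun w ↦ S.g.inner x w e) (key e)
  have h2 := congrArg (fun w ↦ S.g.inner x w (S.φ x e)) (key e)
  have h3 := congrArg (fun w ↦ S.g.inner x w e) (key (S.φ x e))
  have h4 := congrArg (fun w ↦ S.g.inner x w (S.φ x e)) (key (S.φ x e))
  simp only [map_add, add_apply, map_smul, smul_apply, smul_eq_mul, S.inner_ξ_left, S.η_φ,
    he.η_eq_zero, he.norm, he.norm_φ, he.inner_φ_left, S.inner_φ_self, he.φ_φ, map_neg,
    neg_apply, mul_zero, add_zero, mul_one, zero_add, neg_zero] at h1 h2 h3 h4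
  have htr := hS.trace_leviCivita_ξ hE he
  -- Both diagonal entries of `f ∇ξ` on `ker η` equal `a`, so `2 f = 2 a`.
  have ha : a x = S.η x (V x) := by linear_combination (S.η x (V x) * htr - h1 - h4) / 2
  -- The off-diagonal entries are `b` and `-b`, and `∇ξ` is symmetric.
  have hb : b x = 0 := by
    rw [hS.inner_leviCivita_ξ_comm x e, h3] at h2
    linarith
  refine ⟨by rw [hη, ha], ?_⟩
  have h := key v
  rw [hη, ha, hb, zero_smul, add_zero] at h
  rw [eq_sub_of_add_eq h]
  module

end AlmostContactMetricStructure

end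

noncomputable section

/-! ### Functions with logarithmic derivative a `1`-form -/

section LogarithmicDerivative

variable {E : Type*} [NormedAddCommGroup E] [NormedSpace ℝ E]
  {H : Type*} [TopologicalSpace H] {I : ModelWithCorners ℝ E H}
  {M : Type*} [TopologicalSpace M] [ChartedSpace H M] [IsManifold I ∞ M]

/-- A function on a ball whose derivative is bounded by a multiple of the function vanishes as soon
as it vanishes at the centre. -/
theorem eq_zero_on_ball_of_norm_fderiv_le {F : E → ℝ} {z₀ : E} {r C : ℝ}
    (hF : ∀ z ∈ Metric.ball z₀ r, DifferentiableAt ℝ F z)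
    (hC : ∀ z ∈ Metric.ball z₀ r, ‖fderiv ℝ F z‖ ≤ C * ‖F z‖) (h₀ : F z₀ = 0) :
    ∀ z ∈ Metric.ball z₀ r, F z = 0 := by
  intro z hz
  have hr : 0 < r := Metric.pos_of_mem_ball hz
  have hmem : ∀ t ∈ Icc (0 : ℝ) 1, z₀ + t • (z - z₀) ∈ Metric.ball z₀ r := fun t ht ↦
    (convex_ball z₀ r).add_smul_sub_mem (Metric.mem_ball_self hr) hz ht
  have hd : ∀ t ∈ Icc (0 : ℝ) 1, HasDerivAt (fun t : ℝ ↦ F (z₀ + t • (z - z₀)))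
      (fderiv ℝ F (z₀ + t • (z - z₀)) (z - z₀)) t := by
    intro t ht
    have hline : HasDerivAt (fun t : ℝ ↦ z₀ + t • (z - z₀)) (z - z₀) t := by
      simpa using ((hasDerivAt_id t).smul_const (z - z₀)).const_add z₀
    exact (hF _ (hmem t ht)).hasFDerivAt.comp_hasDerivAt t hline
  -- Grönwall along the segment from `z₀` to `z`.
  have key := eq_zero_of_abs_deriv_le_mul_abs_self_of_eq_zero_right
    (f := fun t : ℝ ↦ F (z₀ + t • (z - z₀))) (K := C * ‖z - z₀‖) (a := 0) (b := 1)
    (fun t ht ↦ (hd t ht).continuousAt.continuousWithinAt)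
    (fun t ht ↦ (hd t (Ico_subset_Icc_self ht)).hasDerivWithinAt)
    (by simpa using h₀)
    (fun t ht ↦ by
      refine (ContinuousLinearMap.le_opNorm _ _).trans ?_
      calc _ ≤ C * ‖F (z₀ + t • (z - z₀))‖ * ‖z - z₀‖ := by
            gcongr
            exact hC _ (hmem t (Ico_subset_Icc_self ht))
        _ = _ := by ring)
    1 (by simp)
  simpa using key

/-- If `df = f α` for a smooth `1`-form `α`, then the zero set of `f` is open and closed. -/
theorem isClopen_zeros_of_mvfderiv_eq_mul [I.Boundaryless]
    {α : Π x : M, TangentSpace I x →L[ℝ] ℝ}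
    (hα : ContMDiff I (I.prod 𝓘(ℝ, E →L[ℝ] ℝ)) ∞ (fun x ↦ TotalSpace.mk' (E →L[ℝ] ℝ)
      (E := fun x : M ↦ TangentSpace I x →L[ℝ] ℝ) x (α x)))
    {f : M → ℝ} (hf : MDifferentiable I 𝓘(ℝ) f)
    (hfα : ∀ (x : M) (v : TangentSpace I x), mvfderiv I f x v = f x * α x v) :
    IsClopen {x | f x = 0} := by
  refine ⟨isClosed_eq hf.continuous continuous_const, isOpen_iff_mem_nhds.mpr fun x₀ hx₀ ↦ ?_⟩
  -- The coordinate expression of `α` in the trivialization at `x₀`; its continuity at `x₀` yields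
  -- the local bound `‖β x₀‖ + 1`.
  let β : M → E →L[ℝ] ℝ := fun y ↦
    (α y).comp ((trivializationAt E (TangentSpace I) x₀).symmL ℝ y)
  have hβ : ContinuousAt β x₀ := by
    have h := (contMDiffAt_totalSpace.mp (hα x₀)).2.continuousAt
    refine h.congr (Filter.Eventually.of_forall fun y ↦ ?_)
    refine (congrArg Prod.snd (hom_trivializationAt_apply (RingHom.id ℝ) (F₁ := E)
      (E₁ := (TangentSpace I : M → Type _)) (F₂ := ℝ) (E₂ := Bundle.Trivial M ℝ)
      x₀ ⟨y, α y⟩)).trans ?_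
    ext u
    simp [ContinuousLinearMap.inCoordinates, β]
  have hbound : ∀ᶠ z in 𝓝 (extChartAt I x₀ x₀), z ∈ (extChartAt I x₀).target ∧
      ‖β ((extChartAt I x₀).symm z)‖ ≤ ‖β x₀‖ + 1 := by
    refine Filter.Eventually.and (extChartAt_target_mem_nhds x₀) ?_
    have h1 : ∀ᶠ y in 𝓝 x₀, ‖β y‖ ≤ ‖β x₀‖ + 1 :=
      (hβ.norm.eventually_lt continuousAt_const (by simp)).mono fun y hy ↦ hy.le
    have h2 := continuousAt_extChartAt_symm (I := I) x₀
    rw [ContinuousAt, extChartAt_to_inv] at h2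
    exact h2.eventually h1
  obtain ⟨r, hr, hball⟩ := Metric.eventually_nhds_iff_ball.mp hbound
  have hder : ∀ z ∈ Metric.ball (extChartAt I x₀ x₀) r,
      DifferentiableAt ℝ (f ∘ (extChartAt I x₀).symm) z ∧
      ‖fderiv ℝ (f ∘ (extChartAt I x₀).symm) z‖ ≤
        (‖β x₀‖ + 1) * ‖(f ∘ (extChartAt I x₀).symm) z‖ := by
    intro z hz
    obtain ⟨hzt, hzC⟩ := hball z hz
    have hs := mdifferentiableWithinAt_extChartAt_symm (I := I) hzt
    rw [I.range_eq_univ, mdifferentiableWithinAt_univ] at hs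
    have hy : (extChartAt I x₀).symm z ∈ (chartAt H x₀).source := by
      simpa using (extChartAt I x₀).map_target hzt
    -- The inverse trivialization is the derivative of the inverse chart, so in coordinates `df = f
    -- α` becomes `fderiv = f • β`.
    have hL := TangentBundle.symmL_trivializationAt (I := I) hy
    rw [(extChartAt I x₀).right_inv hzt, I.range_eq_univ, mfderivWithin_univ] at hL
    have hd := (hf ((extChartAt I x₀).symm z)).comp z hs
    refine ⟨hd.differentiableAt, ?_⟩
    have heq : fderiv ℝ (f ∘ (extChartAt I x₀).symm) z =
        f ((extChartAt I x₀).symm z) • β ((extChartAt I x₀).symm z) := by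
      ext u
      have h := mvfderiv_comp_apply z (hf ((extChartAt I x₀).symm z)) hs u
      rw [hfα, ← hL] at h
      rw [← mfderiv_eq_fderiv]
      exact h
    rw [heq, norm_smul, mul_comm]
    exact mul_le_mul_of_nonneg_right hzC (norm_nonneg _)
  have hzero := eq_zero_on_ball_of_norm_fderiv_le (fun z hz ↦ (hder z hz).1)
    (fun z hz ↦ (hder z hz).2) (by simpa using hx₀)
  filter_upwards [(continuousAt_extChartAt (I := I) x₀).eventually (Metric.ball_mem_nhds _ hr),
    extChartAt_source_mem_nhds (I := I) x₀] with y hy hys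
  have h := hzero _ hy
  rwa [Function.comp_apply, (extChartAt I x₀).left_inv hys] at h

end LogarithmicDerivative

end

theorem corollary3p3 {M : Type*} [TopologicalSpace M] [T2Space M] [SecondCountableTopology M]
    [ChartedSpace (EuclideanSpace ℝ (Fin 3)) M] [IsManifold (𝓡 3) ∞ M]
    (S : AlmostContactMetricStructure (𝓡 3) M) (hS : S.IsAlmostKenmotsu)
    (V : Π x : M, TangentSpace (𝓡 3) x) (hV : S.IsHPCV V)
    (hV_ne : ∀ x : M, ∃ y ∈ connectedComponent x, V y ≠ 0)
    (hφV : ∀ x : M, S.φ x (V x) = 0) :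
    S.IsKenmotsu := by
  have hE : Module.finrank ℝ (EuclideanSpace ℝ (Fin 3)) = 3 := by simp
  refine ⟨hS, fun x X Y hX hY ↦ ?_⟩
  have hη : S.η x (V x) ≠ 0 := by
    intro h0
    obtain ⟨y, hy, hVy⟩ := hV_ne x
    -- A zero of `η(V)` at `x` spreads over the component of `x`, where `V = η(V) ξ` would then
    -- vanish.
    have hclopen := isClopen_zeros_of_mvfderiv_eq_mul S.contMDiff_η
      ((S.contMDiff_η_apply hV.1).mdifferentiable (by simp))
      (fun x v ↦ (hS.of_isHPCV hE hV hφV x v).1)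
    have hy0 : S.η y (V y) = 0 := hclopen.connectedComponent_subset h0 hy
    have h := S.φ_φ y (V y)
    rw [hφV, map_zero, hy0, zero_smul, add_zero] at h
    exact hVy (neg_eq_zero.mp h.symm)
  rw [hS.closed x X Y hX hY, zero_smul, add_zero]
  -- Dividing by `η(V) ≠ 0` leaves `∇ξ = 1 - η ⊗ ξ`.
  exact S.nijenhuis_eq_zero hE hX hY fun v ↦
    smul_right_injective _ hη (hS.of_isHPCV hE hV hφV x v).2
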